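/- Let $K$ be a scattered and countably tight compact Hausdorff space; that is, every nonempty subset $S\subset K$ has a point that is isolated in $S$, and for every $A\subset K$ and $x\in\overline{A}$ there is a countable $B\subset A$ with $x\in\overline{B}$. Let $C(K)$ be the Banach space of continuous functions $K\to\mathbb{R}$ with the supremum norm. Then $C(K)$ has the countable separation property (CSP) if and only if $K$ is separable, i.e. has a countable dense subset. Here a subset $\mathcal{F}$ of the dual $X^{*}$ of a real Banach space $X$ is said to separate $X$ if for every $x\in X\setminus\{0\}$ there is $f\in\mathcal{F}$ with $f(x)\neq 0$, and $X$ has CSP if every $\mathcal{F}\subset X^{*}$ that separates $X$ has a countable subset $\mathcal{F}_{0}\subset\mathcal{F}$ that separates $X$. -/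

import Mathlib

/-- A topological space is scattered if every nonempty subset `S` has a point that is isolated
in `S`. -/
def IsScatteredSpace (T : Type*) [TopologicalSpace T] : Prop :=
  ∀ S : Set T, S.Nonempty → ∃ x ∈ S, ∃ U : Set T, IsOpen U ∧ U ∩ S = {x}

/-- A topological space is countably tight if every point in the closure of a set `A` lies in the
closure of some countable subset of `A`. -/
def IsCountablyTightSpace (T : Type*) [TopologicalSpace T] : Prop :=
  ∀ (A : Set T), ∀ x ∈ closure A, ∃ B ⊆ A, B.Countable ∧ x ∈ closure B

/-- A set `F` of continuous linear functionals on a real normed space `X` separates `X` if for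
every `x ≠ 0` some `f ∈ F` has `f x ≠ 0`. -/
def SeparatesSpace {X : Type*} [NormedAddCommGroup X] [NormedSpace ℝ X]
    (F : Set (StrongDual ℝ X)) : Prop :=
  ∀ x : X, x ≠ 0 → ∃ f ∈ F, f x ≠ 0

/-- The countable separation property (CSP): every separating set of functionals contains a
countable separating subset. -/
def HasCSP (X : Type*) [NormedAddCommGroup X] [NormedSpace ℝ X] : Prop :=
  ∀ F : Set (StrongDual ℝ X), SeparatesSpace F →
    ∃ F₀ ⊆ F, F₀.Countable ∧ SeparatesSpace F₀

open Set Filter Topology Metric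
open scoped Pointwise

/-! If CSP holds, apply it to the Dirac functionals, which separate `C(K, ℝ)`: by Urysohn's lemma
the points of a countable separating subfamily are dense.

Conversely, let `F` separate, and let M be `countableHull F`, a separating, weak-* countably closed
subspace of the dual. If M is the whole dual, then each Dirac functional at a point of a countable
dense set is controlled by countably many members of `F`, and all of these together separate. By a
Krein–Šmulian argument (`eq_top_of_isClosed_unitBall`) it suffices that the unit ball of M is weak-*
closed.

This is `isClosed_unitBall`, where both hypotheses on K enter. By Rudin's theorem
(`topologicalClosure_span_dirac`) scatteredness makes every functional a norm limit of finite Dirac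
combinations. Those with n terms and coefficients in [-m, m] form a continuous image of a finite
power of K × [-m, m], which is countably tight, so countably closed sets pull back to closed sets
there. Up to ε, countably many closed sets thus cover the ball, and a Baire-type argument
(`exists_mem_of_mem_closure`) extends the cover to its closure. -/

/-! ### Countably closed sets and countable tightness -/

/-- A set is countably closed if it contains the closure of each of its countable subsets. -/
def IsCountablyClosed {T : Type*} [TopologicalSpace T] (S : Set T) : Prop :=
  ∀ A ⊆ S, A.Countable → closure A ⊆ S

namespace IsCountablyClosed

variable {X Y : Type*} [TopologicalSpace X] [TopologicalSpace Y]

theorem _root_.IsClosed.isCountablyClosed {S : Set X} (hS : IsClosed S) : IsCountablyClosed S :=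
  fun _ hA _ => closure_minimal hA hS

theorem inter {S T : Set X} (hS : IsCountablyClosed S) (hT : IsCountablyClosed T) :
    IsCountablyClosed (S ∩ T) := fun _ hA hc =>
  subset_inter (hS _ (hA.trans inter_subset_left) hc) (hT _ (hA.trans inter_subset_right) hc)

theorem preimage {S : Set Y} (hS : IsCountablyClosed S) {f : X → Y} (hf : Continuous f) :
    IsCountablyClosed (f ⁻¹' S) := fun _ hA hc =>
  (closure_subset_preimage_closure_image hf).trans
    (preimage_mono (hS _ (image_subset_iff.2 hA) (hc.image f)))

/-- Lift a countable subset of the image to a countable set in `S`; the closure of the lift is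
compact, so its image is already closed. -/
theorem image [CompactSpace X] [T2Space Y] {S : Set X} (hS : IsCountablyClosed S) {f : X → Y}
    (hf : Continuous f) : IsCountablyClosed (f '' S) := by
  intro A hA hc
  have hA' : ∀ a : A, ∃ s ∈ S, f s = a := fun a => hA a.2
  choose g hgS hg using hA'
  have := hc.to_subtype
  have hAg : A ⊆ f '' closure (range g) := fun a ha =>
    ⟨g ⟨a, ha⟩, subset_closure (mem_range_self _), hg ⟨a, ha⟩⟩
  exact (closure_minimal hAg (isClosed_closure.isCompact.image hf).isClosed).trans
    (image_mono (hS _ (range_subset_iff.2 hgS) (countable_range g)))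

/-- A countably closed subset of a compact set cannot be covered by countably many closed sets
without these covering its closure. -/
theorem exists_mem_of_mem_closure [RegularSpace X] {S C : Set X} (hS : IsCountablyClosed S)
    (hC : IsCompact C) (hSC : S ⊆ C) {G : ℕ → Set X} (hG : ∀ n, IsClosed (G n))
    (hSG : S ⊆ ⋃ n, G n) {p : X} (hp : p ∈ closure S) : ∃ n, p ∈ G n := by
  by_contra! hpG
  have hV : ∀ n, ∃ V ∈ 𝓝 p, IsClosed V ∧ V ⊆ (G n)ᶜ := fun n =>
    exists_mem_nhds_isClosed_subset ((hG n).isOpen_compl.mem_nhds (hpG n))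
  choose V hVp hVc hVG using hV
  -- A cluster point of a sequence with `m n` in `V 0 ∩ ... ∩ V n` stays in `S` and lies in every `V
  -- i`, hence outside every `G i`.
  have hm : ∀ n : ℕ, ∃ m ∈ S, ∀ i ≤ n, m ∈ V i := by
    intro n
    have : (⋂ i ∈ Iic n, V i) ∈ 𝓝 p := (biInter_mem (finite_Iic n)).2 fun i _ => hVp i
    obtain ⟨m, hm, hmS⟩ := mem_closure_iff_nhds.1 hp _ this
    exact ⟨m, hmS, fun i hi => mem_iInter₂.1 hm i hi⟩
  choose m hmS hmV using hm
  obtain ⟨q, -, hq⟩ := hC.exists_mapClusterPt (u := m) (f := atTop)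
    (tendsto_principal.2 (Eventually.of_forall fun n => hSC (hmS n)))
  have hqS : q ∈ S := hS (range m) (range_subset_iff.2 hmS) (countable_range m)
    (hq.mem_closure_of_mem _ range_mem_map)
  have hqV : ∀ i, q ∈ V i := fun i => by
    have := hq.mem_closure_of_mem (V i) ((eventually_ge_atTop i).mono fun n hn => hmV n i hn)
    rwa [(hVc i).closure_eq] at this
  obtain ⟨n, hn⟩ := mem_iUnion.1 (hSG hqS)
  exact hVG n (hqV n) hn

end IsCountablyClosed

namespace IsCountablyTightSpace

variable {X Y : Type*} [TopologicalSpace X] [TopologicalSpace Y]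

theorem isClosed (hX : IsCountablyTightSpace X) {S : Set X} (hS : IsCountablyClosed S) :
    IsClosed S := by
  refine isClosed_of_closure_subset fun x hx => ?_
  obtain ⟨B, hBS, hB, hxB⟩ := hX S x hx
  exact hS B hBS hB hxB

/-- The points reached from countable subsets of `A` form a countably closed set, since a countable
union of countable sets is countable. -/
theorem of_isClosed (h : ∀ S : Set X, IsCountablyClosed S → IsClosed S) :
    IsCountablyTightSpace X := by
  intro A x hx
  let S : Set X := {y | ∃ B ⊆ A, B.Countable ∧ y ∈ closure B}
  have hS : IsCountablyClosed S := by
    intro C hCS hC y hy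
    have hCS' : ∀ c ∈ C, ∃ B ⊆ A, B.Countable ∧ c ∈ closure B := hCS
    choose! B hBA hB hxB using hCS'
    refine ⟨⋃ c ∈ C, B c, iUnion₂_subset fun c hc => hBA c hc, hC.biUnion fun c hc => hB c hc, ?_⟩
    exact closure_minimal
      (fun c hc => closure_mono (subset_biUnion_of_mem (u := B) hc) (hxB c hc))
      isClosed_closure hy
  have hAS : closure A ⊆ S := closure_minimal
    (fun a ha => ⟨{a}, singleton_subset_iff.2 ha, countable_singleton a, subset_closure rfl⟩)
    (h S hS)
  exact hAS hx

theorem of_firstCountable [FirstCountableTopology X] : IsCountablyTightSpace X := by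
  intro A x hx
  obtain ⟨u, hu, hux⟩ := mem_closure_iff_seq_limit.1 hx
  exact ⟨range u, range_subset_iff.2 hu, countable_range u,
    mem_closure_of_tendsto hux (Eventually.of_forall mem_range_self)⟩

/-- Tightness of `Y` closes the vertical slice of `S` at `x`. Tightness of `X` closes the
projections of `S ∩ (X × V)`, so the slice meets every closed neighbourhood `V` of `y`. -/
theorem prod [CompactSpace X] [T2Space X] [CompactSpace Y] [T2Space Y]
    (hX : IsCountablyTightSpace X) (hY : IsCountablyTightSpace Y) :
    IsCountablyTightSpace (X × Y) := by
  refine of_isClosed fun S hS => isClosed_of_closure_subset ?_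
  rintro ⟨x, y⟩ hxy
  have hclosed : IsClosed (Prod.mk x ⁻¹' S) :=
    hY.isClosed (hS.preimage (Continuous.prodMk_right x))
  refine hclosed.closure_subset (mem_closure_iff_nhds.2 fun W hW => ?_)
  obtain ⟨V, hV, hVc, hVW⟩ := exists_mem_nhds_isClosed_subset hW
  have hproj : IsClosed (Prod.fst '' (S ∩ Prod.snd ⁻¹' V)) := hX.isClosed
    ((hS.inter (hVc.preimage continuous_snd).isCountablyClosed).image continuous_fst)
  have hx : x ∈ Prod.fst '' (S ∩ Prod.snd ⁻¹' V) := by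
    refine hproj.closure_subset (mem_closure_iff_nhds.2 fun U hU => ?_)
    obtain ⟨⟨a, b⟩, ⟨ha, hb⟩, hS'⟩ := mem_closure_iff_nhds.1 hxy _ (prod_mem_nhds hU hV)
    exact ⟨a, ha, ⟨a, b⟩, ⟨hS', hb⟩, rfl⟩
  obtain ⟨⟨a, b⟩, ⟨hab, hb⟩, rfl⟩ := hx
  exact ⟨b, hVW hb, hab⟩

theorem of_surjective [CompactSpace X] [T2Space Y] (hX : IsCountablyTightSpace X) {f : X → Y}
    (hf : Continuous f) (hsurj : Function.Surjective f) : IsCountablyTightSpace Y := by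
  refine of_isClosed fun S hS => ?_
  rw [← image_preimage_eq S hsurj]
  exact ((hX.isClosed (hS.preimage hf)).isCompact.image hf).isClosed

theorem pi_fin [CompactSpace X] [T2Space X] (hX : IsCountablyTightSpace X) (n : ℕ) :
    IsCountablyTightSpace (Fin n → X) := by
  induction n with
  | zero => exact of_firstCountable
  | succ n ih =>
    refine (hX.prod ih).of_surjective (f := fun p => Fin.cons p.1 p.2) ?_ fun g =>
      ⟨(g 0, Fin.tail g), Fin.cons_self_tail g⟩
    exact continuous_pi fun i => by
      refine Fin.cases ?_ (fun j => ?_) i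
      · simpa using continuous_fst
      · simpa [Function.comp_def] using (continuous_apply j).comp continuous_snd

end IsCountablyTightSpace

/-! ### Total subspaces of a dual space with weak-* closed unit ball -/

namespace WeakDual

variable {X : Type*} [NormedAddCommGroup X] [NormedSpace ℝ X]

/-- Bipolar theorem for weak-* closed convex sets containing the origin. -/
theorem exists_eval_gt_one {C : Set (WeakDual ℝ X)} (hconv : Convex ℝ C) (hC : IsClosed C)
    (h0 : 0 ∈ C) {g : WeakDual ℝ X} (hg : g ∉ C) : ∃ y : X, (∀ f ∈ C, f y ≤ 1) ∧ 1 < g y := by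
  have : LocallyConvexSpace ℝ (WeakDual ℝ X) :=
    (inferInstance : LocallyConvexSpace ℝ (WeakBilin (topDualPairing ℝ X)))
  obtain ⟨φ, u, hφC, hφg⟩ := geometric_hahn_banach_closed_point hconv hC hg
  obtain ⟨y, hy⟩ := LinearMap.dualEmbedding_surjective (topDualPairing ℝ X) φ
  have hφ : ∀ f : WeakDual ℝ X, φ f = f y := fun f => by rw [← hy]; rfl
  have hu : 0 < u := by simpa using hφC 0 h0
  refine ⟨u⁻¹ • y, fun f hf => ?_, ?_⟩
  · rw [map_smul, smul_eq_mul, inv_mul_le_iff₀ hu, mul_one, ← hφ]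
    exact (hφC f hf).le
  · rw [map_smul, smul_eq_mul, lt_inv_mul_iff₀ hu, mul_one, ← hφ]
    exact hφg

variable {M : Submodule ℝ (WeakDual ℝ X)}

/-- The unit ball of a subspace of the dual. -/
abbrev unitBall (M : Submodule ℝ (WeakDual ℝ X)) : Set (WeakDual ℝ X) :=
  (M : Set (WeakDual ℝ X)) ∩ toStrongDual ⁻¹' closedBall 0 1

theorem convex_unitBall : Convex ℝ (unitBall M) :=
  M.convex.inter ((convex_closedBall (0 : StrongDual ℝ X) 1).linear_preimage
    (toStrongDual (𝕜 := ℝ) (E := X)).toLinearMap)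

theorem zero_mem_unitBall : (0 : WeakDual ℝ X) ∈ unitBall M := ⟨M.zero_mem, by simp⟩

theorem exists_abs_eval_le_one (hM : IsClosed (unitBall M)) {g : WeakDual ℝ X}
    (hg : g ∉ unitBall M) : ∃ y : X, (∀ f ∈ unitBall M, |f y| ≤ 1) ∧ 1 < g y := by
  obtain ⟨y, hy, hgy⟩ := exists_eval_gt_one convex_unitBall hM zero_mem_unitBall hg
  refine ⟨y, fun f hf => abs_le.2 ⟨?_, hy f hf⟩, hgy⟩
  have h := hy (-f) ⟨M.neg_mem hf.1, by simpa using hf.2⟩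
  have h' : (-f) y = -f y := rfl
  linarith

/-- If `|f x| ≤ ε` on the unit ball of `M`, then subtracting from `x` a vector of norm less than
`2 * ε` halves this bound. -/
theorem exists_sub_bound (hM : IsClosed (unitBall M)) {ε : ℝ} (hε : 0 < ε) {x : X}
    (hx : ∀ f ∈ unitBall M, |f x| ≤ ε) :
    ∃ y : X, ‖x - y‖ < 2 * ε ∧ ∀ f ∈ unitBall M, |f y| ≤ ε / 2 := by
  by_contra! hcon
  let N : Set X := {y | ∀ f ∈ unitBall M, |f y| ≤ ε / 2}
  have hNconv : Convex ℝ N := by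
    intro y hy z hz a b ha hb hab f hf
    rw [map_add, map_smul, map_smul, smul_eq_mul, smul_eq_mul]
    calc |a * f y + b * f z| ≤ |a * f y| + |b * f z| := abs_add_le _ _
      _ = a * |f y| + b * |f z| := by rw [abs_mul, abs_mul, abs_of_nonneg ha, abs_of_nonneg hb]
      _ ≤ a * (ε / 2) + b * (ε / 2) := by
        gcongr
        · exact hy f hf
        · exact hz f hf
      _ = ε / 2 := by rw [← add_mul, hab, one_mul]
  have hN0 : (0 : X) ∈ N := fun f _ => by rw [map_zero, abs_zero]; positivity
  have hxS : x ∉ ball (0 : X) (2 * ε) + N := by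
    rintro ⟨z, hz, y, hy, rfl⟩
    obtain ⟨f, hf, hlt⟩ := hcon y (by simpa using hz)
    exact absurd (hy f hf) (not_le.2 hlt)
  -- The ball summand bounds `‖g‖` by `g x / (2 * ε)`. The summand `N` puts a multiple of `g` in the
  -- bipolar of the unit ball of `M`, which is that ball itself.
  obtain ⟨g, hg⟩ := geometric_hahn_banach_open_point ((convex_ball (0 : X) (2 * ε)).add hNconv)
    isOpen_ball.add_right hxS
  have hgN : ∀ y ∈ N, g y < g x := fun y hy => by
    simpa using hg _ (add_mem_add (mem_ball_self (by positivity)) hy)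
  have hgx : 0 < g x := by simpa using hgN 0 hN0
  have hgball : ∀ z, ‖z‖ < 2 * ε → g z < g x := fun z hz => by
    simpa using hg _ (add_mem_add (mem_ball_zero_iff.2 hz) hN0)
  have hgnorm : ‖g‖ ≤ g x / (2 * ε) := by
    refine le_of_forall_lt fun r hr => ?_
    obtain ⟨z, hz, hrz⟩ := g.exists_lt_apply_of_lt_opNorm hr
    rw [lt_div_iff₀ (by positivity)]
    rcases abs_choice (g z) with h | h
    · have := hgball ((2 * ε) • z) (by
        rw [norm_smul, Real.norm_of_nonneg (by positivity)]; nlinarith)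
      rw [map_smul, smul_eq_mul] at this
      rw [Real.norm_eq_abs, h] at hrz
      nlinarith
    · have := hgball ((-(2 * ε)) • z) (by
        rw [norm_smul, norm_neg, Real.norm_of_nonneg (by positivity)]; nlinarith)
      rw [map_smul, smul_eq_mul] at this
      rw [Real.norm_eq_abs, h] at hrz
      nlinarith
  have hmem : StrongDual.toWeakDual ((ε / 2 / g x) • g) ∈ unitBall M := by
    by_contra hnot
    obtain ⟨y, hy, hgy⟩ := exists_abs_eval_le_one hM hnot
    have h1 := hgN ((ε / 2) • y) fun f hf => by
      rw [map_smul, smul_eq_mul, abs_mul, abs_of_pos (by positivity)]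
      exact mul_le_of_le_one_right (by positivity) (hy f hf)
    have h2 : 1 < ε / 2 / g x * g y := hgy
    rw [map_smul, smul_eq_mul] at h1
    rw [div_mul_eq_mul_div, lt_div_iff₀ hgx] at h2
    linarith
  have hgM : StrongDual.toWeakDual g ∈ M := by
    have := M.smul_mem (ε / 2 / g x)⁻¹ hmem.1
    rwa [map_smul, smul_smul, inv_mul_cancel₀ (by positivity), one_smul] at this
  -- Normalised by its norm bound, `g` takes the value `2 * ε` at `x`, against the assumed bound
  -- `ε`.
  have h3 := hx (StrongDual.toWeakDual ((2 * ε / g x) • g)) ⟨by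
      rw [map_smul]; exact M.smul_mem _ hgM, by
      rw [mem_preimage, mem_closedBall_zero_iff]
      change ‖(2 * ε / g x) • g‖ ≤ 1
      rw [norm_smul, Real.norm_of_nonneg (by positivity)]
      calc 2 * ε / g x * ‖g‖ ≤ 2 * ε / g x * (g x / (2 * ε)) := by gcongr
        _ = 1 := by field_simp⟩
  have h4 : |2 * ε / g x * g x| ≤ ε := h3
  rw [div_mul_cancel₀ _ hgx.ne', abs_of_pos (by positivity)] at h4
  linarith

/-- A total subspace of the dual of a Banach space with weak-* closed unit ball is norming. -/
theorem norm_le_of_forall_abs_le [CompleteSpace X] (hM : IsClosed (unitBall M))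
    (hsep : ∀ x : X, (∀ f ∈ M, f x = 0) → x = 0) {x : X} (hx : ∀ f ∈ unitBall M, |f x| ≤ 1) :
    ‖x‖ ≤ 4 := by
  have step : ∀ (n : ℕ) (y : X), (∀ f ∈ unitBall M, |f y| ≤ (1 / 2) ^ n) →
      ∃ z : X, ‖y - z‖ < 2 * (1 / 2) ^ n ∧ ∀ f ∈ unitBall M, |f z| ≤ (1 / 2) ^ (n + 1) := by
    intro n y hy
    obtain ⟨z, hz, hz'⟩ := exists_sub_bound hM (by positivity) hy
    exact ⟨z, hz, fun f hf => (hz' f hf).trans_eq (by ring)⟩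
  choose! next hnext hnext' using step
  -- The corrections have total norm at most 2 + 1 + 1/2 + ... = 4, and the limit is killed by `M`,
  -- hence zero.
  let u : ℕ → X := fun n => n.rec x next
  have hu : ∀ n, ∀ f ∈ unitBall M, |f (u n)| ≤ (1 / 2) ^ n := by
    intro n
    induction n with
    | zero => simpa [u] using hx
    | succ n ih => exact hnext' n (u n) ih
  have hdist : ∀ n, dist (u n) (u (n + 1)) ≤ 4 / 2 / 2 ^ n := fun n => by
    rw [dist_eq_norm]
    refine (hnext n (u n) (hu n)).le.trans_eq ?_
    rw [one_div, inv_pow]; ring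
  obtain ⟨a, ha⟩ := cauchySeq_tendsto_of_complete (cauchySeq_of_le_geometric_two hdist)
  have hball : ∀ f ∈ unitBall M, f a = 0 := fun f hf => by
    have h1 : Tendsto (fun n => |f (u n)|) atTop (𝓝 |f a|) :=
      (((toStrongDual f).continuous.tendsto a).comp ha).abs
    have h2 : Tendsto (fun n : ℕ => ((1 : ℝ) / 2) ^ n) atTop (𝓝 0) :=
      tendsto_pow_atTop_nhds_zero_of_lt_one (by norm_num) (by norm_num)
    exact abs_nonpos_iff.1 (le_of_tendsto_of_tendsto' h1 h2 fun n => hu n f hf)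
  have ha0 : a = 0 := hsep a fun f hf => by
    have h := hball ((‖toStrongDual f‖ + 1)⁻¹ • f) ⟨M.smul_mem _ hf, by
      rw [mem_preimage, mem_closedBall_zero_iff, map_smul, norm_smul, norm_inv,
        Real.norm_of_nonneg (by positivity), inv_mul_le_iff₀ (by positivity)]
      linarith⟩
    have h' : (‖toStrongDual f‖ + 1)⁻¹ * f a = 0 := h
    exact (mul_eq_zero.1 h').resolve_left (by positivity)
  have := dist_le_of_le_geometric_two_of_tendsto₀ hdist ha
  rwa [ha0, dist_zero_right] at this

/-- Consequence of the Krein–Šmulian theorem: a total subspace of the dual of a Banach space whose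
unit ball is weak-* closed is the whole dual. -/
theorem eq_top_of_isClosed_unitBall [CompleteSpace X] (hM : IsClosed (unitBall M))
    (hsep : ∀ x : X, (∀ f ∈ M, f x = 0) → x = 0) : M = ⊤ := by
  refine eq_top_iff.2 fun p _ => ?_
  -- Chosen so that `c • p` stays below 1 on vectors of norm at most 4.
  set c : ℝ := (4 * (‖toStrongDual p‖ + 1))⁻¹ with hc
  have hc0 : 0 < c := by positivity
  have hmem : c • p ∈ unitBall M := by
    by_contra hnot
    obtain ⟨y, hy, hpy⟩ := exists_abs_eval_le_one hM hnot
    have hy4 := norm_le_of_forall_abs_le hM hsep hy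
    have h1 : (c • p) y = c * toStrongDual p y := rfl
    have h2 : toStrongDual p y ≤ ‖toStrongDual p‖ * 4 :=
      (le_abs_self _).trans (((toStrongDual p).le_opNorm y).trans (by gcongr))
    rw [h1, hc, lt_inv_mul_iff₀ (by positivity)] at hpy
    linarith
  have := M.smul_mem c⁻¹ hmem.1
  rwa [smul_smul, inv_mul_cancel₀ hc0.ne', one_smul] at this

end WeakDual

/-! ### Functionals on `C(K, ℝ)` for scattered `K` -/

/-- An isolated point of a preconnected set is relatively clopen, so it is the whole set. -/
theorem IsScatteredSpace.totallyDisconnectedSpace {T : Type*} [TopologicalSpace T] [T1Space T]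
    (hT : IsScatteredSpace T) : TotallyDisconnectedSpace T := by
  refine ⟨fun S _ hS => ?_⟩
  rcases S.eq_empty_or_nonempty with rfl | hne
  · exact subsingleton_empty
  obtain ⟨x, hxS, U, hU, hUS⟩ := hT S hne
  have hxU : x ∈ U := (hUS.symm ▸ mem_singleton x : x ∈ U ∩ S).1
  intro y hy z hz
  have key : ∀ w ∈ S, w = x := by
    intro w hw
    by_contra hwx
    obtain ⟨v, hvS, hvU, hvx⟩ := hS U {x}ᶜ hU isOpen_compl_singleton
      (fun a _ => by
        by_cases h : a = x
        · exact Or.inl (h ▸ hxU)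
        · exact Or.inr h)
      ⟨x, hxS, hxU⟩ ⟨w, hw, hwx⟩
    exact hvx (hUS ▸ (⟨hvU, hvS⟩ : v ∈ U ∩ S) : v ∈ ({x} : Set T))
  rw [key y hy, key z hz]

namespace ContinuousMap

open TopologicalSpace

variable {K : Type*} [TopologicalSpace K]

/-- The indicator function of a clopen set. -/
noncomputable def clopenIndicator (U : Clopens K) : C(K, ℝ) :=
  ⟨(U : Set K).indicator 1, U.isClopen.continuous_indicator continuous_const⟩

theorem clopenIndicator_of_mem {U : Clopens K} {t : K} (h : t ∈ U) : clopenIndicator U t = 1 :=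
  indicator_of_mem (s := (U : Set K)) h 1

theorem clopenIndicator_of_notMem {U : Clopens K} {t : K} (h : t ∉ U) : clopenIndicator U t = 0 :=
  indicator_of_notMem (s := (U : Set K)) h 1

theorem clopenIndicator_sup {U V : Clopens K} (h : Disjoint (U : Set K) V) :
    clopenIndicator (U ⊔ V) = clopenIndicator U + clopenIndicator V := by
  ext t
  exact congrFun (indicator_union_of_disjoint h (1 : K → ℝ)) t

theorem clopenIndicator_mul (U V : Clopens K) :
    clopenIndicator U * clopenIndicator V = clopenIndicator (U ⊓ V) := by
  ext t
  by_cases hU : t ∈ U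
  · by_cases hV : t ∈ V
    · rw [mul_apply, clopenIndicator_of_mem hU, clopenIndicator_of_mem hV,
        clopenIndicator_of_mem (U := U ⊓ V) ⟨hU, hV⟩, one_mul]
    · rw [mul_apply, clopenIndicator_of_notMem hV,
        clopenIndicator_of_notMem (U := U ⊓ V) fun h => hV h.2, mul_zero]
  · rw [mul_apply, clopenIndicator_of_notMem hU,
      clopenIndicator_of_notMem (U := U ⊓ V) fun h => hU h.1, zero_mul]

variable [CompactSpace K]

/-- The restriction of a functional on `C(K, ℝ)` to a clopen set. -/
noncomputable def restrictClopen (μ : StrongDual ℝ C(K, ℝ)) (U : Clopens K) :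
    StrongDual ℝ C(K, ℝ) :=
  μ.comp (ContinuousLinearMap.mul ℝ C(K, ℝ) (clopenIndicator U))

theorem restrictClopen_apply (μ : StrongDual ℝ C(K, ℝ)) (U : Clopens K) (x : C(K, ℝ)) :
    restrictClopen μ U x = μ (clopenIndicator U * x) := rfl

theorem restrictClopen_top (μ : StrongDual ℝ C(K, ℝ)) : restrictClopen μ ⊤ = μ := by
  ext x
  rw [restrictClopen_apply]
  congr 1
  ext t
  rw [mul_apply, clopenIndicator_of_mem (by trivial), one_mul]

theorem restrictClopen_bot (μ : StrongDual ℝ C(K, ℝ)) : restrictClopen μ ⊥ = 0 := by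
  ext x
  rw [restrictClopen_apply, _root_.zero_apply, ← map_zero μ]
  congr 1
  ext t
  rw [mul_apply, clopenIndicator_of_notMem (U := ⊥) id, zero_mul, zero_apply]

theorem restrictClopen_sup (μ : StrongDual ℝ C(K, ℝ)) {U V : Clopens K}
    (h : Disjoint (U : Set K) V) :
    restrictClopen μ (U ⊔ V) = restrictClopen μ U + restrictClopen μ V := by
  ext x
  rw [_root_.add_apply, restrictClopen_apply, restrictClopen_apply,
    restrictClopen_apply, clopenIndicator_sup h, add_mul, map_add]

theorem norm_clopenIndicator_mul_le (U : Clopens K) (x : C(K, ℝ)) :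
    ‖clopenIndicator U * x‖ ≤ ‖x‖ := by
  refine (norm_le _ (norm_nonneg x)).2 fun t => ?_
  by_cases h : t ∈ U
  · rw [mul_apply, clopenIndicator_of_mem h, one_mul]; exact x.norm_coe_le_norm t
  · rw [mul_apply, clopenIndicator_of_notMem h, zero_mul, norm_zero]; exact norm_nonneg x

/-- The norm is superadditive over disjoint clopen sets. -/
theorem norm_restrictClopen_add_le (μ : StrongDual ℝ C(K, ℝ)) {U V : Clopens K}
    (h : Disjoint (U : Set K) V) :
    ‖restrictClopen μ U‖ + ‖restrictClopen μ V‖ ≤ ‖restrictClopen μ (U ⊔ V)‖ := by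
  have exists_unit : ∀ (f : StrongDual ℝ C(K, ℝ)) {r : ℝ}, r < ‖f‖ → ∃ x, ‖x‖ ≤ 1 ∧ r < f x := by
    intro f r hr
    obtain ⟨x, hx, hrx⟩ := f.exists_lt_apply_of_lt_opNorm hr
    rcases abs_choice (f x) with h | h
    · exact ⟨x, hx.le, by rwa [Real.norm_eq_abs, h] at hrx⟩
    · exact ⟨-x, by rw [norm_neg]; exact hx.le, by rwa [Real.norm_eq_abs, h, ← map_neg] at hrx⟩
  refine le_of_forall_pos_lt_add fun ε hε => ?_
  obtain ⟨x, hx, hrx⟩ := exists_unit (restrictClopen μ U) (sub_lt_self _ (half_pos hε))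
  obtain ⟨y, hy, hry⟩ := exists_unit (restrictClopen μ V) (sub_lt_self _ (half_pos hε))
  -- Glueing near-maximisers on disjoint sets does not increase the supremum norm.
  set z := clopenIndicator U * x + clopenIndicator V * y with hz
  have hz1 : ‖z‖ ≤ 1 := by
    refine (norm_le _ zero_le_one).2 fun t => ?_
    rw [hz, add_apply, mul_apply, mul_apply]
    by_cases htU : t ∈ U
    · rw [clopenIndicator_of_mem htU, clopenIndicator_of_notMem (disjoint_left.1 h htU), one_mul,
        zero_mul, add_zero]
      exact (x.norm_coe_le_norm t).trans hx
    · rw [clopenIndicator_of_notMem htU, zero_mul, zero_add, ← mul_apply]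
      exact (norm_coe_le_norm _ t).trans ((norm_clopenIndicator_mul_le V y).trans hy)
  have hUV : clopenIndicator U * clopenIndicator V = 0 := by
    ext t
    by_cases htU : t ∈ U
    · rw [mul_apply, clopenIndicator_of_notMem (disjoint_left.1 h htU), mul_zero, zero_apply]
    · rw [mul_apply, clopenIndicator_of_notMem htU, zero_mul, zero_apply]
  have hval : restrictClopen μ (U ⊔ V) z = restrictClopen μ U x + restrictClopen μ V y := by
    rw [restrictClopen_apply, restrictClopen_apply, restrictClopen_apply, ← map_add,
      clopenIndicator_sup h, hz]
    congr 1
    have hU : clopenIndicator U * clopenIndicator U = clopenIndicator U := by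
      rw [clopenIndicator_mul, inf_idem]
    have hV : clopenIndicator V * clopenIndicator V = clopenIndicator V := by
      rw [clopenIndicator_mul, inf_idem]
    linear_combination x * hU + y * hV + (x + y) * hUV
  have hle := (le_abs_self _).trans ((restrictClopen μ (U ⊔ V)).le_opNorm z)
  have : ‖restrictClopen μ (U ⊔ V)‖ * ‖z‖ ≤ ‖restrictClopen μ (U ⊔ V)‖ :=
    mul_le_of_le_one_right (norm_nonneg (restrictClopen μ (U ⊔ V))) hz1
  linarith

/-- The Dirac functional at a point. -/
noncomputable abbrev dirac (t : K) : StrongDual ℝ C(K, ℝ) := evalCLM ℝ t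

/-- If every point has a clopen neighbourhood all of whose clopen subsets carry a restriction of `μ`
in `E`, the same holds for every compact set. -/
theorem exists_clopens_restrictClopen_mem {E : Submodule ℝ (StrongDual ℝ C(K, ℝ))}
    (μ : StrongDual ℝ C(K, ℝ)) {C : Set K} (hC : IsCompact C)
    (h : ∀ t ∈ C, ∃ U : Clopens K, t ∈ U ∧ ∀ V ≤ U, restrictClopen μ V ∈ E) :
    ∃ U : Clopens K, C ⊆ U ∧ ∀ V ≤ U, restrictClopen μ V ∈ E := by
  refine hC.induction_on (p := fun s => ∃ U : Clopens K, s ⊆ U ∧ ∀ V ≤ U, restrictClopen μ V ∈ E)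
    ?_ ?_ ?_ ?_
  · refine ⟨⊥, empty_subset _, fun V hV => ?_⟩
    rw [le_bot_iff.1 hV, restrictClopen_bot]
    exact E.zero_mem
  · rintro s s' hss ⟨U, hU, hUE⟩
    exact ⟨U, hss.trans hU, hUE⟩
  · rintro s s' ⟨U, hU, hUE⟩ ⟨U', hU', hUE'⟩
    refine ⟨U ⊔ U', union_subset_union hU hU', fun V hV => ?_⟩
    have hsplit : V = (V ⊓ U) ⊔ (V \ U) := (sup_inf_sdiff V U).symm
    have hdisj : Disjoint ((V ⊓ U : Clopens K) : Set K) (V \ U : Clopens K) :=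
      disjoint_left.2 fun s hs hs' => hs'.2 hs.2
    rw [hsplit, restrictClopen_sup μ hdisj]
    exact E.add_mem (hUE _ inf_le_right) (hUE' _ (sdiff_le_iff.2 hV))
  · intro t ht
    obtain ⟨U, htU, hUE⟩ := h t ht
    exact ⟨U, mem_nhdsWithin_of_mem_nhds (U.isClopen.isOpen.mem_nhds htU), U, subset_rfl, hUE⟩

section Profinite

variable [T2Space K] [TotallyDisconnectedSpace K]

theorem exists_clopens_mem_subset {t : K} {W : Set K} (hW : W ∈ 𝓝 t) :
    ∃ O : Clopens K, t ∈ O ∧ (O : Set K) ⊆ W := by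
  obtain ⟨W', hW', hopen, ht⟩ := mem_nhds_iff.1 hW
  obtain ⟨O, hO, htO, hOW⟩ := compact_exists_isClopen_in_isOpen hopen ht
  exact ⟨⟨O, hO⟩, htO, hOW.trans hW'⟩

/-- A functional which is small on every clopen set missing `t` is close to a multiple of the Dirac
functional at `t`. -/
theorem norm_sub_smul_dirac_le (ν : StrongDual ℝ C(K, ℝ)) (t : K) {ε : ℝ} (hε : 0 ≤ ε)
    (h : ∀ W : Clopens K, t ∉ W → ‖restrictClopen ν W‖ ≤ ε) : ‖ν - ν 1 • dirac t‖ ≤ 2 * ε := by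
  have hvanish : ∀ x : C(K, ℝ), x t = 0 → |ν x| ≤ ε * ‖x‖ := by
    intro x hx
    refine le_of_forall_pos_le_add fun η hη => ?_
    set δ := η / (‖ν‖ + 1) with hδ
    have hδ0 : 0 < δ := by positivity
    have hnhds : {s | |x s| < δ} ∈ 𝓝 t := by
      refine x.continuous.abs.continuousAt.preimage_mem_nhds (Iio_mem_nhds ?_)
      rwa [hx, abs_zero]
    obtain ⟨O, htO, hO⟩ := exists_clopens_mem_subset hnhds
    have hsmall : ‖clopenIndicator O * x‖ ≤ δ := by
      refine (norm_le _ hδ0.le).2 fun s => ?_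
      by_cases hs : s ∈ O
      · rw [mul_apply, clopenIndicator_of_mem hs, one_mul]; exact (hO hs).le
      · rw [mul_apply, clopenIndicator_of_notMem hs, zero_mul, norm_zero]; exact hδ0.le
    have hsplit : ν x = restrictClopen ν O x + restrictClopen ν Oᶜ x := by
      rw [← _root_.add_apply, ← restrictClopen_sup ν (V := Oᶜ) disjoint_compl_right,
        sup_compl_eq_top, restrictClopen_top]
    have h1 : |restrictClopen ν Oᶜ x| ≤ ε * ‖x‖ := ((restrictClopen ν Oᶜ).le_opNorm x).trans
      (mul_le_mul_of_nonneg_right (h _ fun h => h htO) (norm_nonneg x))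
    have h2 : |restrictClopen ν O x| ≤ η := by
      refine (ν.le_opNorm _).trans ((mul_le_mul_of_nonneg_left hsmall (norm_nonneg _)).trans ?_)
      rw [hδ, mul_div_assoc', div_le_iff₀ (by positivity)]
      nlinarith [norm_nonneg ν]
    rw [hsplit]
    linarith [abs_add_le (restrictClopen ν O x) (restrictClopen ν Oᶜ x)]
  refine ContinuousLinearMap.opNorm_le_bound _ (by positivity) fun x => ?_
  -- Subtracting the constant `x t` at most doubles the norm, whence the factor 2.
  have h1 := hvanish (x - x t • 1) (by simp)
  have h2 : (ν - ν 1 • dirac t) x = ν (x - x t • 1) := by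
    simp [dirac, mul_comm]
  have h3 : ‖x - x t • 1‖ ≤ 2 * ‖x‖ := by
    refine (norm_le _ (by positivity)).2 fun s => ?_
    have hs : (x - x t • (1 : C(K, ℝ))) s = x s - x t := by simp
    rw [hs]
    linarith [norm_sub_le (x s) (x t), x.norm_coe_le_norm s, x.norm_coe_le_norm t]
  rw [h2, Real.norm_eq_abs]
  nlinarith

/-- If all restrictions of `μ` to clopen subsets of `U` missing `t` lie in a norm closed subspace
containing the Dirac functional at `t`, then so does the restriction of `μ` to `U`. -/
theorem restrictClopen_mem_of_punctured {E : Submodule ℝ (StrongDual ℝ C(K, ℝ))}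
    (hE : IsClosed (E : Set (StrongDual ℝ C(K, ℝ)))) (μ : StrongDual ℝ C(K, ℝ)) {U : Clopens K}
    {t : K} (ht : dirac t ∈ E) (hU : ∀ V ≤ U, t ∉ V → restrictClopen μ V ∈ E) :
    restrictClopen μ U ∈ E := by
  rw [← SetLike.mem_coe, ← hE.closure_eq]
  refine (Metric.mem_closure_iff (α := StrongDual ℝ C(K, ℝ))).2 fun ε hε => ?_
  let R : Set ℝ := {r | ∃ V ≤ U, t ∉ V ∧ r = ‖restrictClopen μ V‖}
  have hRne : R.Nonempty := ⟨_, ⊥, bot_le, fun h => h.elim, rfl⟩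
  have hRbdd : BddAbove R := by
    refine ⟨‖μ‖, ?_⟩
    rintro _ ⟨V, -, -, rfl⟩
    exact ContinuousLinearMap.opNorm_le_bound _ (norm_nonneg μ) fun x =>
      (μ.le_opNorm _).trans (by gcongr; exact norm_clopenIndicator_mul_le V x)
  -- `V` nearly exhausts the norm of `μ` on clopen sets missing `t`. By superadditivity, any further
  -- such piece of `U \ V` carries at most `ε / 3`.
  obtain ⟨_, ⟨V, hVU, htV, rfl⟩, hV⟩ := exists_lt_of_lt_csSup hRne
    (sub_lt_self (sSup R) (by positivity : 0 < ε / 3))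
  set ν := restrictClopen μ (U \ V) with hν
  have hsmall : ∀ W : Clopens K, t ∉ W → ‖restrictClopen ν W‖ ≤ ε / 3 := by
    intro W htW
    have hW : restrictClopen ν W = restrictClopen μ ((U \ V) ⊓ W) := by
      ext x
      rw [hν, restrictClopen_apply, restrictClopen_apply, restrictClopen_apply, ← mul_assoc,
        clopenIndicator_mul]
    have hdisj : Disjoint (V : Set K) (((U \ V) ⊓ W : Clopens K) : Set K) :=
      disjoint_left.2 fun s hs hs' => hs'.1.2 hs
    have hadd := norm_restrictClopen_add_le μ hdisj
    have hmem : ‖restrictClopen μ (V ⊔ ((U \ V) ⊓ W))‖ ∈ R :=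
      ⟨_, sup_le hVU (inf_le_left.trans sdiff_le), fun h => h.elim htV fun h => htW h.2, rfl⟩
    have := le_csSup hRbdd hmem
    rw [hW]
    linarith
  refine ⟨restrictClopen μ V + ν 1 • dirac t,
    E.add_mem (hU V hVU htV) (E.smul_mem _ ht), ?_⟩
  have hsplit : restrictClopen μ U = restrictClopen μ V + ν := by
    have hdisj : Disjoint (V : Set K) (U \ V : Clopens K) :=
      disjoint_left.2 fun s hs hs' => hs'.2 hs
    rw [hν, ← restrictClopen_sup μ hdisj, sup_sdiff_cancel_right hVU]
  refine (dist_eq_norm (restrictClopen μ U) _).trans_lt ?_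
  rw [hsplit, add_sub_add_left_eq_sub]
  linarith [norm_sub_smul_dirac_le ν t (by positivity) hsmall]

end Profinite

/-- Rudin's theorem: on a scattered compact space, functionals are norm limits of linear
combinations of Dirac functionals. -/
theorem topologicalClosure_span_dirac [T2Space K] (hK : IsScatteredSpace K) :
    (Submodule.span ℝ (range (dirac (K := K)))).topologicalClosure = ⊤ := by
  have := hK.totallyDisconnectedSpace
  set E := (Submodule.span ℝ (range (dirac (K := K)))).topologicalClosure with hEdef
  have hE : IsClosed (E : Set (StrongDual ℝ C(K, ℝ))) := Submodule.isClosed_topologicalClosure _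
  refine eq_top_iff.2 fun μ _ => ?_
  -- The bad points. Around an isolated point of `Z`, compactness handles the clopen sets missing
  -- it, and the puncture lemma then makes the point good.
  let Z : Set K := {t | ¬ ∃ U : Clopens K, t ∈ U ∧ ∀ V ≤ U, restrictClopen μ V ∈ E}
  have hZ : Z = ∅ := by
    by_contra hne
    obtain ⟨t, htZ, O, hO, hOZ⟩ := hK Z (nonempty_iff_ne_empty.2 hne)
    have htO : t ∈ O := (hOZ.symm ▸ mem_singleton t : t ∈ O ∩ Z).1
    obtain ⟨U, htU, hUO⟩ := exists_clopens_mem_subset (hO.mem_nhds htO)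
    have hpunct : ∀ V ≤ U, t ∉ V → restrictClopen μ V ∈ E := by
      intro V hVU htV
      obtain ⟨W, hVW, hW⟩ := exists_clopens_restrictClopen_mem μ V.isClopen.isClosed.isCompact
        (E := E) fun s hs => by
          by_contra hsZ
          have : s ∈ O ∩ Z := ⟨hUO (hVU hs), hsZ⟩
          rw [hOZ, mem_singleton_iff] at this
          exact htV (this ▸ hs)
      exact hW V hVW
    refine htZ ⟨U, htU, fun V hV => ?_⟩
    exact restrictClopen_mem_of_punctured hE μ
      (Submodule.le_topologicalClosure _ (Submodule.subset_span (mem_range_self t)))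
      fun W hW => hpunct W (hW.trans hV)
  obtain ⟨U, hU, hUE⟩ := exists_clopens_restrictClopen_mem μ (isCompact_univ (X := K)) (E := E)
    fun t _ => by
      by_contra h
      exact (hZ ▸ (h : t ∈ Z) : t ∈ (∅ : Set K))
  rw [← restrictClopen_top μ]
  exact hUE ⊤ fun t _ => hU (mem_univ t)

end ContinuousMap

/-! ### Countably weak-* closed subspaces of `C(K, ℝ)*` -/

namespace WeakDual

/-- An enlargement of a bounded countably weak-* closed set by a dual ball is countably weak-*
closed. -/
theorem isCountablyClosed_add_closedBall {X : Type*} [NormedAddCommGroup X] [NormedSpace ℝ X]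
    {S : Set (WeakDual ℝ X)} (hS : IsCountablyClosed S) {r : ℝ}
    (hSr : S ⊆ toStrongDual ⁻¹' closedBall 0 r) (ε : ℝ) :
    IsCountablyClosed (S + toStrongDual ⁻¹' closedBall (0 : StrongDual ℝ X) ε) := by
  intro A hA hc
  have hA' : ∀ a : A, ∃ s ∈ S, ∃ b ∈ toStrongDual ⁻¹' closedBall (0 : StrongDual ℝ X) ε,
      s + b = a := fun a => hA a.2
  choose g hgS b hb hgb using hA'
  have := hc.to_subtype
  -- Boundedness of `S` enters here: a compact set plus a dual ball is weak-* closed.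
  have hcompact : IsCompact (closure (range g)) :=
    (isCompact_closedBall (𝕜 := ℝ) (0 : StrongDual ℝ X) r).of_isClosed_subset isClosed_closure
      (closure_minimal ((range_subset_iff.2 hgS).trans hSr) (isClosed_closedBall 0 r))
  refine (closure_minimal (fun a ha => ?_)
    (hcompact.add (isCompact_closedBall (0 : StrongDual ℝ X) ε)).isClosed).trans
    (add_subset_add_right (hS _ (range_subset_iff.2 hgS) (countable_range g)))
  exact ⟨g ⟨a, ha⟩, subset_closure (mem_range_self _), b ⟨a, ha⟩, hb _, hgb ⟨a, ha⟩⟩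

/-- A countably weak-* closed set is norm closed. -/
theorem mem_of_forall_norm_sub_le {X : Type*} [NormedAddCommGroup X] [NormedSpace ℝ X]
    {S : Set (WeakDual ℝ X)} (hS : IsCountablyClosed S) {p : WeakDual ℝ X}
    (hp : ∀ ε > 0, ∃ f ∈ S, ‖toStrongDual f - toStrongDual p‖ ≤ ε) : p ∈ S := by
  choose f hfS hf using fun n : ℕ => hp (1 / ((n : ℝ) + 1)) Nat.one_div_pos_of_nat
  have hlim : Tendsto (fun n => toStrongDual (f n)) atTop (𝓝 (toStrongDual p)) :=
    tendsto_iff_norm_sub_tendsto_zero.2 (squeeze_zero (fun _ => norm_nonneg _) hf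
      tendsto_one_div_add_atTop_nhds_zero_nat)
  have hlim' : Tendsto f atTop (𝓝 p) :=
    (NormedSpace.Dual.toWeakDual_continuous.tendsto (toStrongDual p)).comp hlim
  exact hS (range f) (range_subset_iff.2 hfS) (countable_range f)
    (mem_closure_of_tendsto hlim' (Eventually.of_forall mem_range_self))

end WeakDual

namespace ContinuousMap

open WeakDual

variable {K : Type*} [TopologicalSpace K]

/-- The combination of `n` Dirac functionals with coefficients in `[-m, m]`. -/
noncomputable def diracSum (n m : ℕ) (p : Fin n → K × Icc (-m : ℝ) m) : WeakDual ℝ C(K, ℝ) :=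
  StrongDual.toWeakDual (∑ i, ((p i).2 : ℝ) • dirac (p i).1)

theorem diracSum_apply (n m : ℕ) (p : Fin n → K × Icc (-m : ℝ) m) (x : C(K, ℝ)) :
    diracSum n m p x = ∑ i, ((p i).2 : ℝ) * x (p i).1 := by
  change (∑ i, ((p i).2 : ℝ) • dirac (p i).1) x = _
  simp [dirac]

theorem continuous_diracSum (n m : ℕ) : Continuous (diracSum (K := K) n m) := by
  refine continuous_of_continuous_eval fun x => ?_
  simp only [diracSum_apply]
  fun_prop

variable [CompactSpace K]

theorem exists_diracSum_norm_sub_le [T2Space K] (hK : IsScatteredSpace K)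
    (μ : StrongDual ℝ C(K, ℝ)) {ε : ℝ} (hε : 0 < ε) :
    ∃ n m p, ‖μ - toStrongDual (diracSum (K := K) n m p)‖ ≤ ε := by
  have hμ : μ ∈ (Submodule.span ℝ (range (dirac (K := K)))).topologicalClosure := by
    rw [topologicalClosure_span_dirac hK]; trivial
  obtain ⟨ν, hν, hdist⟩ := (Metric.mem_closure_iff (α := StrongDual ℝ C(K, ℝ))).1 hμ ε hε
  obtain ⟨n, c, g, rfl⟩ := Submodule.mem_span_set'.1 hν
  choose t ht using fun i => (g i).2
  obtain ⟨m, hm⟩ := exists_nat_ge (∑ i, |c i|)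
  have hc : ∀ i, c i ∈ Icc (-m : ℝ) m := fun i => abs_le.1
    ((Finset.single_le_sum (f := fun i => |c i|) (fun j _ => abs_nonneg _)
      (Finset.mem_univ i)).trans hm)
  refine ⟨n, m, fun i => (t i, ⟨c i, hc i⟩), ?_⟩
  refine le_of_eq_of_le ?_ ((dist_eq_norm μ _).symm.trans_le hdist.le)
  have hsum : toStrongDual (diracSum (K := K) n m fun i => (t i, ⟨c i, hc i⟩)) =
      ∑ i, c i • (g i : StrongDual ℝ C(K, ℝ)) := by
    ext x
    rw [toStrongDual_apply, diracSum_apply]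
    simp [← ht, dirac]
  rw [hsum]

variable [T2Space K]

/-- Countably weak-* closed subspaces of the dual of `C(K, ℝ)` have weak-* closed unit ball. -/
theorem isClosed_unitBall (hscat : IsScatteredSpace K) (htight : IsCountablyTightSpace K)
    {M : Submodule ℝ (WeakDual ℝ C(K, ℝ))}
    (hM : IsCountablyClosed (M : Set (WeakDual ℝ C(K, ℝ)))) : IsClosed (unitBall M) := by
  refine isClosed_of_closure_subset fun p hp => ⟨?_, ?_⟩
  swap
  · exact closure_minimal inter_subset_right (isClosed_closedBall 0 1) hp
  have hball : IsCountablyClosed (unitBall M) :=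
    hM.inter (isClosed_closedBall 0 1).isCountablyClosed
  refine mem_of_forall_norm_sub_le hM fun ε hε => ?_
  let B : Set (WeakDual ℝ C(K, ℝ)) := toStrongDual ⁻¹' closedBall (0 : StrongDual ℝ C(K, ℝ)) (ε / 2)
  have hB : IsCompact B := isCompact_closedBall (0 : StrongDual ℝ C(K, ℝ)) (ε / 2)
  have hBmem : ∀ b, b ∈ B ↔ ‖toStrongDual b‖ ≤ ε / 2 := fun b =>
    mem_closedBall_zero_iff (E := StrongDual ℝ C(K, ℝ))
  have hBneg : ∀ b ∈ B, -b ∈ B := fun b hb =>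
    (hBmem _).2 ((norm_neg (toStrongDual b)).trans_le ((hBmem b).1 hb))
  -- Dirac sums of a given size within `ε / 2` of the unit ball, thickened by `ε / 2`: every element
  -- of `G k` is within `ε` of `M`.
  let G : ℕ × ℕ → Set (WeakDual ℝ C(K, ℝ)) := fun k =>
    diracSum k.1 k.2 '' (diracSum k.1 k.2 ⁻¹' (unitBall M + B)) + B
  have hG : ∀ k, IsClosed (G k) := by
    rintro ⟨n, m⟩
    have hT : IsCountablyTightSpace (Fin n → K × Icc (-m : ℝ) m) :=
      (htight.prod IsCountablyTightSpace.of_firstCountable).pi_fin n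
    have hpre : IsClosed (diracSum n m ⁻¹' (unitBall M + B)) := hT.isClosed
      ((isCountablyClosed_add_closedBall hball inter_subset_right (ε / 2)).preimage
        (continuous_diracSum n m))
    exact ((hpre.isCompact.image (continuous_diracSum n m)).add hB).isClosed
  have hcover : unitBall M ⊆ ⋃ j, G (Nat.unpair j) := by
    intro μ hμ
    obtain ⟨n, m, q, hq⟩ := exists_diracSum_norm_sub_le hscat (toStrongDual μ) (half_pos hε)
    have hb : μ - diracSum n m q ∈ B := (hBmem _).2 hq
    refine mem_iUnion.2 ⟨Nat.pair n m, ?_⟩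
    rw [Nat.unpair_pair]
    refine ⟨_, ⟨q, ⟨μ, hμ, _, hBneg _ hb, ?_⟩, rfl⟩, _, hb, add_sub_cancel _ _⟩
    change μ + -(μ - diracSum n m q) = diracSum n m q
    rw [neg_sub, add_sub_cancel]
  obtain ⟨j, hj⟩ := hball.exists_mem_of_mem_closure
    (isCompact_closedBall (0 : StrongDual ℝ C(K, ℝ)) 1) inter_subset_right
    (fun j => hG (Nat.unpair j)) hcover hp
  obtain ⟨_, ⟨q, ⟨μ, hμ, b, hb, hq⟩, rfl⟩, b', hb', rfl⟩ := hj
  refine ⟨μ, hμ.1, ?_⟩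
  rw [← hq, map_add, map_add, norm_sub_rev, add_assoc, add_sub_cancel_left]
  have h1 : ‖toStrongDual b‖ ≤ ε / 2 := (hBmem _).1 hb
  have h2 : ‖toStrongDual b'‖ ≤ ε / 2 := (hBmem _).1 hb'
  linarith [norm_add_le (toStrongDual b) (toStrongDual b')]

end ContinuousMap

/-! ### The countable hull of a separating family and the two implications. -/

/-- The functionals vanishing on the common kernel of some countable subset of `F`. -/
def countableHull {X : Type*} [NormedAddCommGroup X] [NormedSpace ℝ X]
    (F : Set (StrongDual ℝ X)) : Submodule ℝ (WeakDual ℝ X) where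
  carrier := {μ | ∃ F₀ ⊆ F, F₀.Countable ∧ ∀ x, (∀ f ∈ F₀, f x = 0) → μ x = 0}
  zero_mem' := ⟨∅, empty_subset F, countable_empty, fun _ _ => rfl⟩
  add_mem' := by
    rintro μ ν ⟨F₁, h₁, hc₁, hμ⟩ ⟨F₂, h₂, hc₂, hν⟩
    refine ⟨F₁ ∪ F₂, union_subset h₁ h₂, hc₁.union hc₂, fun x hx => ?_⟩
    change μ x + ν x = 0
    rw [hμ x fun f hf => hx f (Or.inl hf), hν x fun f hf => hx f (Or.inr hf), add_zero]
  smul_mem' := by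
    rintro c μ ⟨F₁, h₁, hc₁, hμ⟩
    refine ⟨F₁, h₁, hc₁, fun x hx => ?_⟩
    change c * μ x = 0
    rw [hμ x hx, mul_zero]

theorem isCountablyClosed_countableHull {X : Type*} [NormedAddCommGroup X] [NormedSpace ℝ X]
    (F : Set (StrongDual ℝ X)) :
    IsCountablyClosed (countableHull F : Set (WeakDual ℝ X)) := by
  intro A hA hc p hp
  have hA' : ∀ a : A, ∃ F₀ ⊆ F, F₀.Countable ∧ ∀ x, (∀ f ∈ F₀, f x = 0) → a.1 x = 0 :=
    fun a => hA a.2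
  choose G hGF hG hker using hA'
  have := hc.to_subtype
  refine ⟨⋃ a, G a, iUnion_subset hGF, countable_iUnion hG, fun x hx => ?_⟩
  exact closure_minimal (t := {f : WeakDual ℝ X | f x = 0})
    (fun a ha => hker ⟨a, ha⟩ x fun f hf => hx f (mem_iUnion.2 ⟨_, hf⟩))
    (isClosed_eq (WeakDual.eval_continuous x) continuous_const) hp

theorem separableSpace_of_hasCSP {K : Type*} [TopologicalSpace K] [CompactSpace K] [T2Space K]
    (h : HasCSP C(K, ℝ)) : TopologicalSpace.SeparableSpace K := by
  obtain ⟨F₀, hF₀, hc, hsep⟩ := h (range (ContinuousMap.dirac (K := K))) fun x hx => by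
    obtain ⟨t, ht⟩ := DFunLike.ne_iff.1 hx
    exact ⟨_, mem_range_self t, ht⟩
  have hF₀' : ∀ f : F₀, ∃ t, ContinuousMap.dirac (K := K) t = f := fun f => hF₀ f.2
  choose t ht using hF₀'
  have := hc.to_subtype
  refine ⟨range t, countable_range t, fun s => ?_⟩
  by_contra hs
  obtain ⟨x, hx0, hx1, -⟩ := exists_continuous_zero_one_of_isClosed
    (isClosed_closure (s := range t)) isClosed_singleton (disjoint_singleton_right.2 hs)
  have hxs : x s = 1 := hx1 rfl
  obtain ⟨f, hf, hfx⟩ := hsep x fun h => by simp [h] at hxs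
  refine hfx ?_
  have : ContinuousMap.dirac (t ⟨f, hf⟩) x = 0 := hx0 (subset_closure (mem_range_self _))
  rwa [ht] at this

theorem hasCSP_of_separableSpace {K : Type*} [TopologicalSpace K] [CompactSpace K] [T2Space K]
    (hscat : IsScatteredSpace K) (htight : IsCountablyTightSpace K)
    [TopologicalSpace.SeparableSpace K] : HasCSP C(K, ℝ) := by
  intro F hF
  -- The hull contains `F`, so it separates.
  have htop : countableHull F = ⊤ := by
    refine WeakDual.eq_top_of_isClosed_unitBall (ContinuousMap.isClosed_unitBall hscat htight
      (isCountablyClosed_countableHull F)) fun x hx => ?_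
    by_contra hne
    obtain ⟨f, hf, hfx⟩ := hF x hne
    exact hfx (hx (StrongDual.toWeakDual f)
      ⟨{f}, singleton_subset_iff.2 hf, countable_singleton f, fun y hy => hy f rfl⟩)
  obtain ⟨D, hD, hdense⟩ := TopologicalSpace.exists_countable_dense K
  have hmem : ∀ t : K, ∃ F₀ ⊆ F, F₀.Countable ∧
      ∀ x : C(K, ℝ), (∀ f ∈ F₀, f x = 0) → x t = 0 := fun t =>
    (htop ▸ Submodule.mem_top :
      StrongDual.toWeakDual (ContinuousMap.dirac t) ∈ countableHull F)
  choose G hGF hG hker using hmem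
  refine ⟨⋃ t ∈ D, G t, iUnion₂_subset fun t _ => hGF t, hD.biUnion fun t _ => hG t, fun x hx => ?_⟩
  by_contra! hcon
  refine hx (DFunLike.coe_injective (x.continuous.ext_on hdense continuous_const fun t ht => ?_))
  exact hker t x fun f hf => hcon f (mem_biUnion ht hf)

theorem theorem3p7 {K : Type*} [TopologicalSpace K] [CompactSpace K] [T2Space K]
    (hscat : IsScatteredSpace K) (htight : IsCountablyTightSpace K) :
    HasCSP C(K, ℝ) ↔ TopologicalSpace.SeparableSpace K :=
  ⟨separableSpace_of_hasCSP, fun _ => hasCSP_of_separableSpace hscat htight⟩
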